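/- For $n\ge 1$ let $\mathbb{H}_{2n+1}(\mathbb{Z})$ be the discrete Heisenberg group, that is, $\mathbb{Z}^n\times\mathbb{Z}^n\times\mathbb{Z}$ with $(x,y,z)(x',y',z')=(x+x',\,y+y',\,z+z'+x\cdot y')$. **Definitions.** Let $\Gamma$ be a countable discrete group with identity $e$. A *Følner sequence* in $\Gamma$ is an increasing sequence $\{F_k\}$ of finite subsets of $\Gamma$ with $e\in F_k$ for all $k$, $\bigcup_k F_k=\Gamma$, and $\lim_{k\to\infty}|gF_k\bigtriangleup F_k|/|F_k|=0$ for every $g\in\Gamma$. It is *symmetric* if $F_k^{-1}=F_k$ for all $k$. $\Gamma$ satisfies *(WAFC) with a symmetric Følner sequence* if there are a symmetric Følner sequence $\{F_k\}$ in $\Gamma$ and a natural number $L$ such that for every $k$ the set $F_k^{-1}F_k$ is covered by at most $L$ left translates $gF_k$ $(g\in\Gamma)$ of $F_k$. Let $\Gamma$ act by homeomorphisms on a nonempty compact metric space $X$. The action is *free* if $gx=x$ for some $x\in X$ implies $g=e$. The *topological Rokhlin dimension* of $(X,\Gamma)$ is the smallest integer $D\ge 0$ with the following property (and $\infty$ if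 there is none): there is a Følner sequence $\{F_k\}$ in $\Gamma$ such that for every $k$ there are nonempty open sets $U_0,\dots,U_D\subset X$ such that for each $i$ the sets $g\overline{U_i}$ $(g\in F_k)$ are pairwise disjoint, and $\bigcup_{i=0}^{D}\bigcup_{g\in F_k}gU_i=X$. **Corollary.** Let $n\ge 1$, let $X$ be a nonempty compact metric space of finite Lebesgue covering dimension, and let $G$ be a countable discrete group which is one of the following: 1. a finite group; 2. a finitely generated abelian group; 3. a locally finite group (every finitely generated subgroup is finite); 4. a group satisfying (WAFC) with a symmetric Følner sequence. Then every free action of $\mathbb{H}_{2n+1}(\mathbb{Z})\times G$ on $X$ by homeomorphisms has finite topological Rokhlin dimension. -/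

import Mathlib

open Filter
open scoped Topology Pointwise symmDiff

/-! ### The discrete Heisenberg groups -/

/-- The underlying set `ℤⁿ × ℤⁿ × ℤ` of the discrete Heisenberg group `ℍ₂ₙ₊₁(ℤ)`. The triple
`(x, y, z)` stands for the upper unitriangular `(n + 2) × (n + 2)` integer matrix with first row
`(1, x, z)`, last column `(z, y, 1)` and identity middle block. -/
@[ext]
structure Heisenberg (n : ℕ) where
  x : Fin n → ℤ
  y : Fin n → ℤ
  z : ℤ

namespace Heisenberg

variable {n : ℕ}

instance : One (Heisenberg n) := ⟨⟨0, 0, 0⟩⟩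

/-- Matrix multiplication: `(x, y, z) (x', y', z') = (x + x', y + y', z + z' + x ⬝ y')`. -/
instance : Mul (Heisenberg n) := ⟨fun a b => ⟨a.x + b.x, a.y + b.y, a.z + b.z + a.x ⬝ᵥ b.y⟩⟩

instance : Inv (Heisenberg n) := ⟨fun a => ⟨-a.x, -a.y, -a.z + a.x ⬝ᵥ a.y⟩⟩

@[simp] theorem one_x : (1 : Heisenberg n).x = 0 := rfl
@[simp] theorem one_y : (1 : Heisenberg n).y = 0 := rfl
@[simp] theorem one_z : (1 : Heisenberg n).z = 0 := rfl
@[simp] theorem mul_x (a b : Heisenberg n) : (a * b).x = a.x + b.x := rfl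
@[simp] theorem mul_y (a b : Heisenberg n) : (a * b).y = a.y + b.y := rfl
@[simp] theorem mul_z (a b : Heisenberg n) : (a * b).z = a.z + b.z + a.x ⬝ᵥ b.y := rfl
@[simp] theorem inv_x (a : Heisenberg n) : (a⁻¹).x = -a.x := rfl
@[simp] theorem inv_y (a : Heisenberg n) : (a⁻¹).y = -a.y := rfl
@[simp] theorem inv_z (a : Heisenberg n) : (a⁻¹).z = -a.z + a.x ⬝ᵥ a.y := rfl

instance : Group (Heisenberg n) :=
  Group.ofLeftAxioms
    (by
      intro a b c
      ext
      · simp [add_assoc]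
      · simp [add_assoc]
      · simp only [mul_z, mul_x, mul_y, add_dotProduct, dotProduct_add]; ring)
    (by intro a; ext <;> simp)
    (by intro a; ext <;> simp)

end Heisenberg

/-! ### Følner sequences and approximate groups -/

section Groups

/-- A Følner sequence: an increasing sequence of finite sets that contain the identity and
exhaust the group, with `|g Fₙ ∆ Fₙ| / |Fₙ| → 0` for every `g`. -/
structure IsFolnerSequence {G : Type*} [Group G] (F : ℕ → Set G) : Prop where
  finite : ∀ n, (F n).Finite
  one_mem : ∀ n, (1 : G) ∈ F n
  monotone : Monotone F
  iUnion_eq : ⋃ n, F n = Set.univ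
  tendsto : ∀ g : G,
    Tendsto (fun n => (((g • F n) ∆ F n).ncard : ℝ) / ((F n).ncard : ℝ)) atTop (𝓝 0)

/-- `A` is a (weakly) approximate group with respect to `L`: it is finite, it contains the
identity, and `A⁻¹ A` is covered by `L` left translates of `A`. -/
structure IsWeakApproxGroup {G : Type*} [Group G] (L : ℕ) (A : Set G) : Prop where
  pos : 0 < L
  finite : A.Finite
  one_mem : (1 : G) ∈ A
  cover : ∃ g : Fin L → G, A⁻¹ * A ⊆ ⋃ i, g i • A

/-- The weakly approximate Følner condition (WAFC) for `(G, F)` with respect to `L`: the least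
constant of each `Fₙ` is at most `L`. -/
structure IsWAFC {G : Type*} [Group G] (F : ℕ → Set G) (L : ℕ) : Prop where
  folner : IsFolnerSequence F
  approx : ∀ n, ∃ k ≤ L, IsWeakApproxGroup k (F n)

/-- `G` satisfies (WAFC) for some symmetric Følner sequence and some constant. -/
def HasSymmetricWAFC (G : Type*) [Group G] : Prop :=
  ∃ (F : ℕ → Set G) (L : ℕ), (∀ n, (F n)⁻¹ = F n) ∧ IsWAFC F L

/-- A group is locally finite if every finitely generated subgroup is finite. -/
def IsLocallyFiniteGroup (G : Type*) [Group G] : Prop :=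
  ∀ H : Subgroup G, H.FG → Finite H

end Groups

/-! ### Lebesgue covering dimension -/

section Dimension

/-- A finite open cover of `X`. -/
structure IsFiniteOpenCover {X : Type*} [TopologicalSpace X] (U : Set (Set X)) : Prop where
  finite : U.Finite
  isOpen : ∀ O ∈ U, IsOpen O
  cover : ⋃₀ U = Set.univ

/-- Every finite open cover of `X` has a finite open refinement of order at most `d`, that is,
one in which each point lies in at most `d + 1` members. -/
def CoveringDimLE (X : Type*) [TopologicalSpace X] (d : ℕ) : Prop :=
  ∀ U : Set (Set X), IsFiniteOpenCover U →
    ∃ V : Set (Set X), IsFiniteOpenCover V ∧ (∀ v ∈ V, ∃ u ∈ U, v ⊆ u) ∧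
      ∀ x : X, {v ∈ V | x ∈ v}.ncard ≤ d + 1

/-- The Lebesgue covering dimension of a nonempty space. -/
noncomputable def coveringDim (X : Type*) [TopologicalSpace X] : ℕ∞ :=
  ⨅ (d : ℕ) (_ : CoveringDimLE X d), (d : ℕ∞)

end Dimension

/-! ### Topological Rokhlin dimension -/

section Rokhlin

/-- A tower `(U, S)`: a nonempty set `U` and a finite set `S` of group elements such that the
levels `g U`, `g ∈ S`, are pairwise disjoint. -/
structure IsTower {Γ X : Type*} [Group Γ] [MulAction Γ X] (U : Set X) (S : Set Γ) : Prop where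
  nonempty : U.Nonempty
  finite : S.Finite
  disjoint : S.PairwiseDisjoint (fun g : Γ => g • U)

/-- There is a Følner sequence `F` such that for every `n` there are `D + 1` open sets
`U₀, …, U_D` for which each `(closure Uᵢ, Fₙ)` is a tower and the sets `Fₙ Uᵢ` cover `X`. -/
def TopRokhlinDimLE (Γ X : Type*) [Group Γ] [TopologicalSpace X] [MulAction Γ X] (D : ℕ) : Prop :=
  ∃ F : ℕ → Set Γ, IsFolnerSequence F ∧
    ∀ n, ∃ U : Fin (D + 1) → Set X,
      (∀ i, IsOpen (U i)) ∧
      (∀ i, IsTower (closure (U i)) (F n)) ∧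
      ⋃ i, ⋃ g ∈ F n, g • U i = Set.univ

/-- The topological Rokhlin dimension: the smallest `D` as above, and `⊤` if there is none. -/
noncomputable def topRokhlinDim (Γ X : Type*) [Group Γ] [TopologicalSpace X] [MulAction Γ X] : ℕ∞ :=
  ⨅ (D : ℕ) (_ : TopRokhlinDimLE Γ X D), (D : ℕ∞)

/-- A free action: only the identity has a fixed point. -/
def IsFreeAction (Γ X : Type*) [Group Γ] [MulAction Γ X] : Prop :=
  ∀ (g : Γ) (x : X), g • x = x → g = 1

end Rokhlin

/-! The group has a Følner sequence of symmetric sets `F` that are approximate subgroups with one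
common constant `L`. For such a group, acting freely on a space of covering dimension at most `d`, a
marker argument bounds the Rokhlin dimension by `(d + 1) * ((L ^ 8 + 1) * L) - 1`.

If `X` were zero-dimensional, clopen sets would suffice: greedily chosen maximal `F ^ 8`-separated
clopen sets are bases of towers, and counting in `F ^ 9` shows that `L ^ 8 + 1` rounds exhaust the
space (`exists_separated_cover`, `exists_towers`). In general, `d + 1` perturbed copies of a family
of bump functions are taken. By general position and Baire category, every point has a copy none of
whose functions vanishes anywhere on its orbit (`exists_near_generalPosition`). On the invariant set
`Z s` of points good for copy `s`, the positivity sets of that copy behave like clopen sets: their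
frontiers miss `Z s`. The marker argument uses only Boolean operations and translations, so it runs
in the algebra of sets with this property, and passing to interiors loses no point of `Z s`.

Such Følner sequences pass to products. For the Heisenberg group they are boxes of side `k` in `x`
and `y` and `k ^ 2` in the centre, the scaling under which the group law is homogeneous. -/

/-! ### General position in dimension `d` -/

/-- Finitely many vectors can be moved into general position by an arbitrarily small
perturbation. -/
theorem exists_near_linearIndepOn {ι E : Type*} [NormedAddCommGroup E] [NormedSpace ℝ E]
    [FiniteDimensional ℝ E] (a : ι → E) {ε : ℝ} (hε : 0 < ε) (s : Finset ι) :
    ∃ w : ι → E, (∀ i, dist (w i) (a i) < ε) ∧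
      ∀ t ⊆ s, t.card ≤ Module.finrank ℝ E → LinearIndepOn ℝ w (t : Set ι) := by
  classical
  induction s using Finset.induction_on with
  | empty =>
    refine ⟨a, fun i => by simpa using hε, fun t ht _ => ?_⟩
    rw [Finset.subset_empty.1 ht]
    simp
  | insert i s hi ih =>
    obtain ⟨w, hw, hind⟩ := ih
    borelize E
    let μ : MeasureTheory.Measure E := MeasureTheory.Measure.addHaar
    -- Proper subspaces are Haar null, so the admissible choices of the new vector are dense.
    have hae : ∀ᵐ v ∂μ, ∀ t ∈ s.powerset.filter (fun t => t.card < Module.finrank ℝ E),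
        v ∉ Submodule.span ℝ (w '' (t : Set ι)) := by
      rw [Finset.eventually_all]
      intro t ht
      rw [Finset.mem_filter] at ht
      have hne : Submodule.span ℝ (w '' (t : Set ι)) ≠ ⊤ := by
        intro h
        have h1 : Module.finrank ℝ (Submodule.span ℝ ((t.image w : Finset E) : Set E)) ≤
            (t.image w).card := finrank_span_finset_le_card _
        rw [Finset.coe_image, h, finrank_top] at h1
        have := Finset.card_image_le (s := t) (f := w)
        omega
      have h0 := MeasureTheory.Measure.addHaar_submodule μ _ hne
      exact MeasureTheory.compl_mem_ae_iff.2 h0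
    obtain ⟨v, hvd, hv⟩ := (MeasureTheory.Measure.dense_of_ae hae).exists_dist_lt (a i) hε
    refine ⟨Function.update w i v, fun j => ?_, fun t ht hc => ?_⟩
    · rcases eq_or_ne j i with rfl | h
      · simpa [dist_comm] using hv
      · simpa [h] using hw j
    · have hcongr : ∀ r : Finset ι, i ∉ r → Set.EqOn (Function.update w i v) w (r : Set ι) := by
        intro r hr j hj
        have : j ≠ i := fun h => hr (h ▸ hj)
        simp [this]
      by_cases hit : i ∈ t
      · have hsub : t.erase i ⊆ s := Finset.subset_insert_iff.1 ht
        have hcard : (t.erase i).card < Module.finrank ℝ E := by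
          have := Finset.card_erase_add_one hit
          omega
        have hnot : i ∉ ((t.erase i : Finset ι) : Set ι) := by simp
        rw [← Finset.insert_erase hit, Finset.coe_insert, linearIndepOn_insert hnot]
        refine ⟨(linearIndepOn_congr (hcongr _ (by simp))).2 (hind _ hsub hcard.le), ?_⟩
        rw [(hcongr _ (by simp)).image_eq, Function.update_self]
        exact hvd (t.erase i) (by simp [hsub, hcard, -Finset.card_erase_of_mem])
      · have hsub : t ⊆ s := (Finset.subset_insert_iff_of_notMem hit).1 ht
        exact (linearIndepOn_congr (hcongr _ hit)).2 (hind _ hsub hc)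

/-- On a compact space of covering dimension at most `d`, a continuous map to a normed space of
dimension greater than `d` can be perturbed to avoid the origin. -/
theorem CoveringDimLE.exists_near_ne_zero {X E : Type*} [TopologicalSpace X] [CompactSpace X]
    [T2Space X] [NormedAddCommGroup E] [NormedSpace ℝ E] [FiniteDimensional ℝ E] {d : ℕ}
    (hX : CoveringDimLE X d) (hE : d + 1 ≤ Module.finrank ℝ E) (f : C(X, E)) {ε : ℝ}
    (hε : 0 < ε) :
    ∃ g : C(X, E), (∀ x, dist (g x) (f x) < ε) ∧ ∀ x, g x ≠ 0 := by
  classical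
  have hε2 : 0 < ε / 2 := half_pos hε
  obtain ⟨T, hT⟩ := isCompact_univ.elim_finite_subcover
    (fun e : E => f ⁻¹' Metric.ball e (ε / 4)) (fun e => Metric.isOpen_ball.preimage f.continuous)
    (fun x _ => Set.mem_iUnion.2 ⟨f x, by simp [hε]⟩)
  obtain ⟨V, hV, hVU, hord⟩ := hX ((fun e : E => f ⁻¹' Metric.ball e (ε / 4)) '' (T : Set E))
    { finite := T.finite_toSet.image _
      isOpen := by
        rintro _ ⟨e, _, rfl⟩
        exact Metric.isOpen_ball.preimage f.continuous
      cover := by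
        refine Set.eq_univ_of_univ_subset (hT.trans ?_)
        rw [Set.sUnion_image]
        exact subset_rfl }
  choose! e heT heq using hVU
  have hfin : Finite V := hV.finite
  obtain ⟨_⟩ := nonempty_fintype V
  obtain ⟨p, hp⟩ := PartitionOfUnity.exists_isSubordinate isClosed_univ
    (fun v : V => (v : Set X)) (fun v => hV.isOpen v v.2)
    (by rw [← Set.sUnion_eq_iUnion, hV.cover])
  have hosc : ∀ v : V, ∃ c : E, ∀ x ∈ (v : Set X), dist c (f x) < ε / 4 := by
    intro v
    obtain ⟨c, _, hc⟩ := heT v v.2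
    refine ⟨c, fun x hx => ?_⟩
    have := heq v v.2 hx
    rw [← hc] at this
    simpa [dist_comm] using this
  choose c hc using hosc
  obtain ⟨w, hw, hind⟩ := exists_near_linearIndepOn c (show 0 < ε / 4 by positivity)
    (Finset.univ : Finset V)
  have hsum : ∀ x, ∑ v, p v x = 1 := fun x => by
    rw [← finsum_eq_sum_of_fintype]; exact p.sum_eq_one (Set.mem_univ x)
  have hsupp : ∀ v x, p v x ≠ 0 → x ∈ (v : Set X) := fun v x h =>
    hp v (subset_tsupport _ h)
  -- At most `d + 1` weights `p v x` are nonzero at `x`, and the corresponding `w v` are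
  -- independent. A zero of the sum would make all weights vanish, but they add up to 1.
  refine ⟨⟨fun x => ∑ v, p v x • w v, by fun_prop⟩, fun x => ?_, fun x hx => ?_⟩
  · have hx : (∑ v, p v x • w v) ∈ Metric.ball (f x) ε := by
      have := (convex_ball (f x) ε).sum_mem (t := Finset.univ.filter (fun v => p v x ≠ 0))
        (w := fun v => p v x) (z := w) (fun v _ => p.nonneg v x)
        (by rw [Finset.sum_filter_ne_zero]; exact hsum x) (fun v hv => by
          have h1 := hc v x (hsupp v x (Finset.mem_filter.1 hv).2)
          have h2 := hw v
          have h3 := dist_triangle (w v) (c v) (f x)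
          rw [Metric.mem_ball]; linarith)
      rwa [Finset.sum_filter_of_ne] at this
      intro v _ hv h0
      exact hv (by simp [h0])
    exact hx
  · let t : Finset V := Finset.univ.filter (fun v => p v x ≠ 0)
    have hcard : t.card ≤ Module.finrank ℝ E := by
      refine le_trans ?_ ((hord x).trans hE)
      rw [← Finset.card_image_of_injective t Subtype.val_injective, ← Set.ncard_coe_finset]
      refine Set.ncard_le_ncard ?_ (hV.finite.subset (Set.sep_subset _ _))
      intro v hv
      obtain ⟨v', hv', rfl⟩ := Finset.mem_image.1 (Finset.mem_coe.1 hv)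
      exact ⟨v'.2, hsupp v' x (Finset.mem_filter.1 hv').2⟩
    have hli := linearIndepOn_finset_iff.1 (hind t (Finset.subset_univ _) hcard)
      (fun v => p v x) (by
        rw [Finset.sum_filter_of_ne]
        · exact hx
        · intro v _ hv h0
          exact hv (by simp [h0]))
    have h1 := hsum x
    rw [Finset.sum_eq_zero] at h1
    · exact zero_ne_one h1
    · intro v _
      by_contra h
      exact h (hli v (Finset.mem_filter.2 ⟨Finset.mem_univ _, h⟩))

/-- Over a compact space of covering dimension at most `d` with an action of a countable group,
`d + 1` copies of a finite family of functions can be perturbed so that no point has, for every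
copy, a translate on which some function of this copy vanishes. -/
theorem CoveringDimLE.exists_near_generalPosition {Γ X J : Type*} [Group Γ] [Countable Γ]
    [MetricSpace X] [CompactSpace X] [MulAction Γ X] [ContinuousConstSMul Γ X] [Finite J]
    {d : ℕ} (hX : CoveringDimLE X d) (f : J → C(X, ℝ)) {ε : ℝ} (hε : 0 < ε) :
    ∃ φ : Fin (d + 1) → J → C(X, ℝ), (∀ s j x, dist (φ s j x) (f j x) < ε) ∧
      ∀ (γ : Fin (d + 1) → Γ) (j : Fin (d + 1) → J) (x : X), ∃ s, φ s (j s) (γ s • x) ≠ 0 := by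
  classical
  obtain ⟨_⟩ := nonempty_fintype J
  -- Baire category: there are countably many pairs `q`, each giving an open condition (by
  -- compactness of `X`) that is also dense.
  let O : (Fin (d + 1) → Γ) × (Fin (d + 1) → J) → Set (Fin (d + 1) → J → C(X, ℝ)) :=
    fun q => {φ | ∀ x, ∃ s, φ s (q.2 s) (q.1 s • x) ≠ 0}
  let Ψ (q : (Fin (d + 1) → Γ) × (Fin (d + 1) → J)) (φ : Fin (d + 1) → J → C(X, ℝ)) :
      C(X, Fin (d + 1) → ℝ) := ⟨fun x s => φ s (q.2 s) (q.1 s • x), by fun_prop⟩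
  have hopen : ∀ q, IsOpen (O q) := by
    intro q
    have hc : Continuous (Ψ q) := by
      refine ContinuousMap.continuous_of_continuous_uncurry _ ?_
      simp only [Ψ, Function.uncurry_def, ContinuousMap.coe_mk]
      fun_prop
    have := (ContinuousMap.isOpen_setOfPred_mapsTo (X := X) isCompact_univ
      (isOpen_compl_singleton (x := (0 : Fin (d + 1) → ℝ)))).preimage hc
    convert this using 1
    ext φ
    simp [O, Ψ, Set.MapsTo, funext_iff]
  have hdense : ∀ q, Dense (O q) := by
    intro q
    rw [Metric.dense_iff]
    intro φ r hr
    obtain ⟨g, hg, hg0⟩ := hX.exists_near_ne_zero (by simp) (Ψ q φ) hr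
    -- Each coordinate of `g` is transported back by its own group element. Distinct coordinates
    -- alter distinct copies, so the changes cannot conflict; this is why `d + 1` copies are used.
    refine ⟨fun s k => if k = q.2 s then
      ⟨fun x => g ((q.1 s)⁻¹ • x) s, by fun_prop⟩ else φ s k, ?_, ?_⟩
    · rw [Metric.mem_ball, dist_pi_lt_iff hr]
      intro s
      rw [dist_pi_lt_iff hr]
      intro k
      split_ifs with hk
      · rw [ContinuousMap.dist_lt_iff hr]
        intro x
        have := (dist_le_pi_dist _ _ s).trans_lt (hg ((q.1 s)⁻¹ • x))
        simpa [Ψ, hk] using this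
      · simpa using hr
    · intro x
      obtain ⟨s, hs⟩ := Function.ne_iff.1 (hg0 x)
      exact ⟨s, by simpa using hs⟩
  have : BaireSpace (Fin (d + 1) → J → C(X, ℝ)) :=
    BaireSpace.of_completelyPseudoMetrizable
  obtain ⟨φ, hφ, hφf⟩ := (dense_iInter_of_isOpen hopen hdense).exists_dist_lt
    (fun _ => f) hε
  refine ⟨φ, fun s j x => ?_, fun γ j x => Set.mem_iInter.1 hφ (γ, j) x⟩
  rw [dist_comm, dist_pi_lt_iff hε] at hφf
  have h1 := hφf s
  rw [dist_pi_lt_iff hε] at h1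
  exact (ContinuousMap.dist_apply_le_dist x).trans_lt (h1 j)

/-! ### Markers and towers in an invariant algebra -/

/-- Sets that meet each `P`-neighbourhood in at most one point. -/
def IsSeparated {Γ X : Type*} [Group Γ] [MulAction Γ X] (P : Set Γ) (A : Set X) : Prop :=
  ∀ g ∈ P, ∀ a ∈ A, g • a ∈ A → g • a = a

/-- An algebra of subsets that is invariant under a group action. -/
structure IsInvariantSetAlgebra (Γ : Type*) {X : Type*} [Group Γ] [MulAction Γ X]
    (C : Set X → Prop) : Prop where
  univ : C Set.univ
  union : ∀ {A B}, C A → C B → C (A ∪ B)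
  sdiff : ∀ {A B}, C A → C B → C (A \ B)
  smul : ∀ (g : Γ) {A}, C A → C (g • A)

namespace IsInvariantSetAlgebra

variable {Γ X : Type*} [Group Γ] [MulAction Γ X] {C : Set X → Prop}

theorem inter (hC : IsInvariantSetAlgebra Γ C) {A B : Set X} (hA : C A) (hB : C B) :
    C (A ∩ B) := by
  rw [← Set.sdiff_sdiff_right_self]
  exact hC.sdiff hA (hC.sdiff hA hB)

theorem finset_smul (hC : IsInvariantSetAlgebra Γ C) (P : Finset Γ) {A : Set X} (hA : C A) :
    C ((P : Set Γ) • A) := by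
  classical
  induction P using Finset.induction_on with
  | empty => simpa using hC.sdiff hA hA
  | insert g P _ ih =>
    rw [Finset.coe_insert, Set.insert_eq, Set.union_smul, Set.singleton_smul]
    exact hC.union (hC.smul g hA) ih

/-- Greedy construction of a maximal separated set in an invariant algebra. -/
theorem exists_maximal_separated (hC : IsInvariantSetAlgebra Γ C) (P : Finset Γ)
    (hP1 : 1 ∈ P) (hPinv : ∀ g ∈ P, g⁻¹ ∈ P) {J : Type*} (V : J → Set X) (hV : ∀ j, C (V j))
    (hVP : ∀ j, IsSeparated (P : Set Γ) (V j)) {Y : Set X} (hY : C Y) (s : Finset J) :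
    ∃ A, C A ∧ A ⊆ Y ∧ IsSeparated (P : Set Γ) A ∧
      ∀ y ∈ Y, ∀ j ∈ s, y ∈ V j → ∃ g ∈ P, g • y ∈ A := by
  classical
  induction s using Finset.induction_on with
  | empty =>
    exact ⟨∅, by simpa using hC.sdiff hY hY, Set.empty_subset _, by simp [IsSeparated], by simp⟩
  | insert j s _ ih =>
    obtain ⟨A, hA, hAY, hAP, hAs⟩ := ih
    -- Points that are `P`-close to `A` are discarded; the others can be added all at once because
    -- `V j` is itself separated.
    refine ⟨A ∪ (V j ∩ Y) \ ((P : Set Γ) • A),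
      hC.union hA (hC.sdiff (hC.inter (hV j) hY) (hC.finset_smul P hA)),
      Set.union_subset hAY (Set.sdiff_subset.trans Set.inter_subset_right), ?_, ?_⟩
    · rintro g hg a (ha | ha) (hb | hb)
      · exact hAP g hg a ha hb
      · exact absurd (Set.smul_mem_smul hg ha) hb.2
      · refine absurd ?_ ha.2
        have := Set.smul_mem_smul (Finset.mem_coe.2 (hPinv g hg)) hb
        rwa [inv_smul_smul] at this
      · exact hVP j g hg a ha.1.1 hb.1.1
    · intro y hy k hk hyk
      rcases Finset.mem_insert.1 hk with rfl | hk
      · by_cases hyA : y ∈ (P : Set Γ) • A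
        · obtain ⟨g, hg, a, ha, rfl⟩ := hyA
          exact ⟨g⁻¹, hPinv g hg, Or.inl (by simpa using ha)⟩
        · exact ⟨1, hP1, Or.inr (by simpa using ⟨⟨hyk, hy⟩, hyA⟩)⟩
      · obtain ⟨g, hg, h⟩ := hAs y hy k hk hyk
        exact ⟨g, hg, Or.inl h⟩

/-- Boundedly many `P`-separated sets in an invariant algebra have `F⁻¹ F`-translates that cover
the space. -/
theorem exists_separated_cover [DecidableEq Γ] (hC : IsInvariantSetAlgebra Γ C) (P F : Finset Γ)
    (hP1 : 1 ∈ P) (hPinv : ∀ g ∈ P, g⁻¹ ∈ P) {J : Type*} [Finite J] (V : J → Set X)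
    (hV : ∀ j, C (V j)) (hVP : ∀ j, IsSeparated (P : Set Γ) (V j)) (hVX : ⋃ j, V j = Set.univ)
    {N : ℕ} (hN : (F * P).card < N * F.card) :
    ∃ A : Fin N → Set X, (∀ i, C (A i)) ∧ (∀ i, IsSeparated (P : Set Γ) (A i)) ∧
      ∀ x, ∃ i, ∃ g ∈ F⁻¹ * F, ∃ a ∈ A i, g • a = x := by
  obtain ⟨_⟩ := nonempty_fintype J
  have hmax : ∀ Y : Set X, ∃ A, C Y → (C A ∧ A ⊆ Y ∧ IsSeparated (P : Set Γ) A ∧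
      ∀ y ∈ Y, ∃ g ∈ P, g • y ∈ A) := by
    intro Y
    by_cases hY : C Y
    · obtain ⟨A, h1, h2, h3, h4⟩ :=
        hC.exists_maximal_separated P hP1 hPinv V hV hVP hY Finset.univ
      refine ⟨A, fun _ => ⟨h1, h2, h3, fun y hy => ?_⟩⟩
      obtain ⟨j, hj⟩ := Set.mem_iUnion.1 (hVX.ge (Set.mem_univ y))
      exact h4 y hy j (Finset.mem_univ j) hj
    · exact ⟨∅, fun h => absurd h hY⟩
  choose A hA using hmax
  let K : Finset Γ := F⁻¹ * F
  let Y : ℕ → Set X := fun k => (fun Y => Y \ ((K : Set Γ) • A Y))^[k] Set.univ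
  have hY0 : Y 0 = Set.univ := rfl
  have hYs : ∀ k, Y (k + 1) = Y k \ ((K : Set Γ) • A (Y k)) := fun k =>
    Function.iterate_succ_apply' _ _ _
  have hYC : ∀ k, C (Y k) := by
    intro k
    induction k with
    | zero => exact hC.univ
    | succ k ih => rw [hYs]; exact hC.sdiff ih (hC.finset_smul K (hA _ ih).1)
  have hanti : Antitone Y := antitone_nat_of_succ_le fun k => by
    rw [hYs]; exact Set.sdiff_subset
  refine ⟨fun i => A (Y i), fun i => (hA _ (hYC i)).1, fun i => (hA _ (hYC i)).2.2.1, fun x => ?_⟩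
  by_contra! hx
  have hxY : ∀ k ≤ N, x ∈ Y k := by
    intro k
    induction k with
    | zero => intro _; trivial
    | succ k ih =>
      intro hk
      rw [hYs]
      refine ⟨ih (by omega), ?_⟩
      rintro ⟨g, hg, a, ha, hga⟩
      exact hx ⟨k, by omega⟩ g hg a ha hga
  have hg : ∀ i : Fin N, ∃ g ∈ P, g • x ∈ A (Y i) := fun i =>
    (hA _ (hYC i)).2.2.2 x (hxY i i.2.le)
  choose g hgP hgA using hg
  -- A point surviving `N` rounds is `P`-close to every marker set `A (Y i)`. A coincidence `f * g i
  -- = f' * g j` would put `g j • x` in the part removed at round `i`. Hence the sets `F * g i` are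
  -- disjoint in `F * P`, contradicting `hN`.
  have hdis : ∀ i j : Fin N, i < j → ∀ f ∈ F, ∀ f' ∈ F, f * g i ≠ f' * g j := by
    intro i j hij f hf f' hf' h
    have h1 : g j • x ∈ Y (i + 1) :=
      hanti (Nat.succ_le_of_lt (Fin.lt_def.1 hij)) ((hA _ (hYC j)).2.1 (hgA j))
    rw [hYs] at h1
    refine h1.2 ⟨f'⁻¹ * f, ?_, g i • x, hgA i, ?_⟩
    · exact Finset.mul_mem_mul (Finset.inv_mem_inv hf') hf
    · change (f'⁻¹ * f) • g i • x = g j • x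
      rw [smul_smul, mul_assoc, h, inv_mul_cancel_left]
  have hcard : N * F.card ≤ (F * P).card := by
    have hinj : Set.InjOn (fun q : Fin N × Γ => q.2 * g q.1)
        ((Finset.univ ×ˢ F : Finset (Fin N × Γ)) : Set (Fin N × Γ)) := by
      rintro ⟨i, f⟩ hf ⟨j, f'⟩ hf' h
      have hf1 : f ∈ F := by simpa using hf
      have hf2 : f' ∈ F := by simpa using hf'
      rcases lt_trichotomy i j with hij | rfl | hij
      · exact absurd h (hdis i j hij f hf1 f' hf2)
      · simpa using h
      · exact absurd h.symm (hdis j i hij f' hf2 f hf1)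
    have := Finset.card_le_card_of_injOn (t := F * P) _ (fun q hq =>
      Finset.mul_mem_mul (by simpa using hq) (hgP q.1)) hinj
    simpa using this
  omega

end IsInvariantSetAlgebra

/-- A translate that meets `F ^ 2` has its translating element in `F ^ 2 * F⁻¹ = F ^ 3`; the other
indices are filled with 1. The location in `F ^ 3` bounds the conjugates that occur in
`exists_towers`. -/
theorem IsApproximateSubgroup.exists_translates {Γ : Type*} [Group Γ] {L : ℕ} {F : Set Γ}
    (hF : IsApproximateSubgroup (L : ℝ) F) :
    ∃ t : Fin L → Γ, (∀ i, t i ∈ F ^ 3) ∧ F ^ 2 ⊆ ⋃ i, t i • F := by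
  classical
  obtain ⟨T, hT, hTF⟩ := hF.sq_covBySMul
  have hT' : T.card ≤ L := by exact_mod_cast hT
  have h1 : (1 : Γ) ∈ F ^ 3 := Set.one_mem_pow hF.one_mem
  let u : ℕ → Γ := fun i => if h : i < T.card then (T.equivFin.symm ⟨i, h⟩ : Γ) else 1
  refine ⟨fun i => if u i ∈ F ^ 3 then u i else 1, fun i => ?_, fun x hx => ?_⟩
  · dsimp only
    split_ifs with h
    exacts [h, h1]
  · obtain ⟨t, ht, f, hf, rfl⟩ := hTF hx
    obtain ⟨i, hi⟩ := T.equivFin.symm.surjective ⟨t, ht⟩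
    have hu : u i = t := by simp [u, hi]
    have ht3 : t ∈ F ^ 3 := by
      have h2 : t = (t • f) * f⁻¹ := by simp
      rw [h2, pow_succ]
      refine Set.mul_mem_mul hx ?_
      rw [← hF.inv_eq_self]
      exact Set.inv_mem_inv.2 hf
    refine Set.mem_iUnion.2 ⟨⟨i, i.2.trans_le hT'⟩, ?_⟩
    simp only [hu, ht3, if_true]
    exact Set.smul_mem_smul_set hf

namespace IsInvariantSetAlgebra

variable {Γ X : Type*} [Group Γ] [MulAction Γ X] {C : Set X → Prop}

/-- The towers over an approximate group in an invariant algebra. -/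
theorem exists_towers (hC : IsInvariantSetAlgebra Γ C) (hfree : IsFreeAction Γ X) {L : ℕ}
    {F : Set Γ} (hfin : F.Finite) (hF : IsApproximateSubgroup (L : ℝ) F) {J : Type*} [Finite J]
    (V : J → Set X) (hV : ∀ j, C (V j)) (hVF : ∀ j, IsSeparated (F ^ 8) (V j))
    (hVX : ⋃ j, V j = Set.univ) :
    ∃ U : Fin (L ^ 8 + 1) × Fin L → Set X, (∀ q, C (U q)) ∧
      (∀ q, F.PairwiseDisjoint (fun g => g • U q)) ∧ ∀ x, ∃ q, ∃ g ∈ F, x ∈ g • U q := by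
  classical
  lift F to Finset Γ using hfin
  have hinv : F⁻¹ = F := by
    have := hF.inv_eq_self
    rw [← Finset.coe_inv] at this
    exact Finset.coe_injective this
  have hpos : 0 < F.card := Finset.card_pos.2 ⟨1, hF.one_mem⟩
  have hcard : (F * F ^ 8).card < (L ^ 8 + 1) * F.card := by
    have h1 : ((F ^ 9).card : ℝ) ≤ (L : ℝ) ^ 8 * F.card := hF.card_pow_le (n := 9)
    have h2 : (F ^ 9).card ≤ L ^ 8 * F.card := by exact_mod_cast h1
    rw [← pow_succ', add_mul]
    exact h2.trans_lt (by omega)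
  have hPinv : (F ^ 8)⁻¹ = F ^ 8 := by rw [← inv_pow, hinv]
  obtain ⟨A, hAC, hAP, hAX⟩ := hC.exists_separated_cover (F ^ 8) F
    (Finset.one_mem_pow hF.one_mem)
    (fun g hg => by rw [← hPinv]; exact Finset.inv_mem_inv hg) V hV
    (fun j => by rw [Finset.coe_pow]; exact hVF j) hVX hcard
  obtain ⟨t, ht, htF⟩ := hF.exists_translates
  have hinvmem : ∀ g ∈ F, g⁻¹ ∈ F := fun g hg => by rw [← hinv]; exact Finset.inv_mem_inv hg
  -- The markers cover by `F ^ 2`-translates; writing `g⁻¹ = t k * f` turns these into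
  -- `F`-translates of `(t k)⁻¹ • A i`. If two levels meet, then `p = t k * f'⁻¹ * f * (t k)⁻¹`
  -- moves a point of `A i` into `A i`. Since 3 + 1 + 1 + 3 = 8, separation and freeness give `p =
  -- 1`.
  refine ⟨fun q => (t q.2)⁻¹ • A q.1, fun q => hC.smul _ (hAC _), ?_, fun x => ?_⟩
  · rintro ⟨i, k⟩ f hf f' hf' hne
    refine Set.disjoint_left.2 ?_
    rintro _ ⟨_, ⟨a, ha, rfl⟩, rfl⟩ ⟨_, ⟨a', ha', rfl⟩, h⟩
    simp only [smul_smul] at h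
    let p : Γ := t k * f'⁻¹ * f * (t k)⁻¹
    have hp : p • a = a' := by
      rw [eq_comm, ← inv_smul_eq_iff, smul_smul] at h
      rw [← h]
      congr 1
      simp only [p]
      group
    have hpF : p ∈ ((F ^ 8 : Finset Γ) : Set Γ) := by
      rw [Finset.coe_pow]
      have h3 : (t k)⁻¹ ∈ (F : Set Γ) ^ 3 := by
        have : ((F : Set Γ) ^ 3)⁻¹ = (F : Set Γ) ^ 3 := by rw [← inv_pow, hF.inv_eq_self]
        rw [← this]
        exact Set.inv_mem_inv.2 (ht k)
      have h8 : (F : Set Γ) ^ 8 = (F : Set Γ) ^ 3 * F * F * (F : Set Γ) ^ 3 := by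
        rw [← pow_succ, ← pow_succ, ← pow_add]
      rw [h8]
      exact Set.mul_mem_mul (Set.mul_mem_mul (Set.mul_mem_mul (ht k) (hinvmem f' hf')) hf) h3
    have hpa := hAP i p hpF a ha (hp ▸ ha')
    have hp1 : p = 1 := hfree p a hpa
    apply hne
    have : f'⁻¹ * f = 1 := by
      have h4 : f'⁻¹ * f = (t k)⁻¹ * p * t k := by simp only [p]; group
      rw [h4, hp1]; group
    exact (inv_mul_eq_one.1 this).symm
  · obtain ⟨i, g, hg, a, ha, rfl⟩ := hAX x
    have hg2 : g⁻¹ ∈ (F : Set Γ) ^ 2 := by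
      have h5 : ((F : Set Γ) ^ 2)⁻¹ = (F : Set Γ) ^ 2 := by rw [← inv_pow, hF.inv_eq_self]
      rw [hinv, ← sq, ← Finset.mem_coe, Finset.coe_pow, ← h5] at hg
      exact hg
    obtain ⟨k, hk⟩ := Set.mem_iUnion.1 (htF hg2)
    obtain ⟨f, hf, hfg⟩ := hk
    refine ⟨(i, k), f⁻¹, hinvmem f hf, (t k)⁻¹ • a, Set.smul_mem_smul_set ha, ?_⟩
    have hfg' : t k * f = g⁻¹ := hfg
    change f⁻¹ • (t k)⁻¹ • a = g • a
    rw [smul_smul, ← mul_inv_rev, hfg', inv_inv]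

end IsInvariantSetAlgebra

/-! ### From towers in the algebra to Rokhlin dimension -/

/-- The sets whose frontier avoids an invariant set form an invariant algebra. -/
theorem isInvariantSetAlgebra_disjoint_frontier {Γ X : Type*} [Group Γ] [TopologicalSpace X]
    [MulAction Γ X] [ContinuousConstSMul Γ X] {Z : Set X} (hZ : ∀ (g : Γ), ∀ x ∈ Z, g • x ∈ Z) :
    IsInvariantSetAlgebra Γ (fun S : Set X => Disjoint (frontier S) Z) where
  univ := by simp
  union {A B} hA hB := by
    refine Disjoint.mono_left (frontier_union_subset A B) ?_
    exact Disjoint.union_left (hA.mono_left Set.inter_subset_left)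
      (hB.mono_left Set.inter_subset_right)
  sdiff {A B} hA hB := by
    rw [Set.sdiff_eq]
    refine Disjoint.mono_left (frontier_inter_subset A Bᶜ) ?_
    rw [frontier_compl]
    exact Disjoint.union_left (hA.mono_left Set.inter_subset_left)
      (hB.mono_left Set.inter_subset_right)
  smul g {A} hA := by
    have h : frontier (g • A) = g • frontier A := ((Homeomorph.smul g).image_frontier A).symm
    rw [h, Set.disjoint_left]
    rintro _ ⟨a, ha, rfl⟩ hz
    have := hZ g⁻¹ _ hz
    simp only [inv_smul_smul] at this
    exact Set.disjoint_left.1 hA ha this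

/-- The shrinking lemma, applied to the cover by all levels, gives smaller levels; pulled back to
the base, they form an open set whose closure lies in the old base. -/
theorem topRokhlinDimLE_of_open_towers {Γ X I : Type*} [Group Γ] [TopologicalSpace X] [NormalSpace X]
    [Nonempty X] [MulAction Γ X] [ContinuousConstSMul Γ X] [Fintype I] {D : ℕ}
    (hI : Fintype.card I = D + 1) {F : ℕ → Set Γ} (hF : IsFolnerSequence F)
    (h : ∀ n, ∃ U : I → Set X, (∀ i, IsOpen (U i)) ∧
      (∀ i, (F n).PairwiseDisjoint (fun g => g • U i)) ∧ ∀ x, ∃ i, ∃ g ∈ F n, x ∈ g • U i) :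
    TopRokhlinDimLE Γ X D := by
  classical
  refine ⟨F, hF, fun n => ?_⟩
  obtain ⟨U, hUo, hUd, hUX⟩ := h n
  have : Finite (F n) := hF.finite n
  obtain ⟨v, hvX, hvo, hvU⟩ := exists_iUnion_eq_closure_subset
    (u := fun q : I × F n => (q.2 : Γ) • U q.1) (fun q => (hUo q.1).smul _)
    (fun x => Set.toFinite _) (by
      refine Set.eq_univ_of_forall fun x => ?_
      obtain ⟨i, g, hg, hx⟩ := hUX x
      exact Set.mem_iUnion.2 ⟨(i, ⟨g, hg⟩), hx⟩)
  let W : I → Set X := fun i => ⋃ g : F n, (g : Γ)⁻¹ • v (i, g)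
  have hWo : ∀ i, IsOpen (W i) := fun i => isOpen_iUnion fun g => (hvo _).smul _
  have hWU : ∀ i, closure (W i) ⊆ U i := by
    intro i
    rw [closure_iUnion_of_finite]
    refine Set.iUnion_subset fun g => ?_
    rw [closure_smul, Set.smul_set_subset_iff_subset_inv_smul_set, inv_inv]
    exact hvU (i, g)
  have hWX : ∀ x, ∃ i, ∃ g ∈ F n, x ∈ g • W i := by
    intro x
    obtain ⟨⟨i, g⟩, hx⟩ := Set.mem_iUnion.1 (hvX.ge (Set.mem_univ x))
    refine ⟨i, g, g.2, Set.mem_smul_set_iff_inv_smul_mem.2 (Set.mem_iUnion.2 ⟨g, ?_⟩)⟩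
    exact Set.smul_mem_smul_set hx
  obtain ⟨x₀⟩ := ‹Nonempty X›
  obtain ⟨i₀, g₀, _, y, hy, _⟩ := hWX x₀
  -- Bases must be nonempty, so an empty one is replaced by a copy of a nonempty one; different
  -- towers may overlap.
  have hW' : ∀ i, ∃ j, (W j).Nonempty ∧ ((W i).Nonempty → j = i) := fun i =>
    if h : (W i).Nonempty then ⟨i, h, fun _ => rfl⟩ else ⟨i₀, ⟨y, hy⟩, fun h' => absurd h' h⟩
  choose j hj hji using hW'
  let e : Fin (D + 1) ≃ I := (Fintype.equivFinOfCardEq hI).symm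
  refine ⟨fun k => W (j (e k)), fun k => hWo _, fun k => ⟨(hj _).closure, hF.finite n, ?_⟩, ?_⟩
  · exact (hUd _).mono_on fun g _ => Set.smul_set_mono (hWU _)
  · refine Set.eq_univ_of_forall fun x => ?_
    obtain ⟨i, g, hg, hx⟩ := hWX x
    have hne : (W i).Nonempty := by
      obtain ⟨y, hy, _⟩ := hx
      exact ⟨y, hy⟩
    refine Set.mem_iUnion.2 ⟨e.symm i, Set.mem_iUnion₂.2 ⟨g, hg, ?_⟩⟩
    simpa only [Equiv.apply_symm_apply, hji i hne] using hx

/-- Finitely many nontrivial elements of a group acting freely on a compact space displace all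
points by a definite amount. -/
theorem IsFreeAction.exists_displacement {Γ X : Type*} [Group Γ] [MetricSpace X] [CompactSpace X]
    [Nonempty X] [MulAction Γ X] [ContinuousConstSMul Γ X] (hfree : IsFreeAction Γ X) {P : Set Γ}
    (hP : P.Finite) : ∃ δ > 0, ∀ g ∈ P, g ≠ 1 → ∀ x : X, δ ≤ dist (g • x) x := by
  have h : ∀ g ∈ P, ∀ᶠ δ in 𝓝[>] (0 : ℝ), g ≠ 1 → ∀ x : X, δ ≤ dist (g • x) x := by
    intro g _
    by_cases hg : g = 1
    · simp [hg]
    · obtain ⟨x₀, -, hx₀⟩ := isCompact_univ.exists_isMinOn Set.univ_nonempty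
        (f := fun x : X => dist (g • x) x) (by fun_prop)
      have hpos : 0 < dist (g • x₀) x₀ := dist_pos.2 fun h => hg (hfree g x₀ h)
      filter_upwards [Ioo_mem_nhdsGT hpos] with δ hδ _ x
      exact hδ.2.le.trans (hx₀ (Set.mem_univ x))
  obtain ⟨δ, h1, h2⟩ := (((eventually_all_finite hP).2 h).and self_mem_nhdsWithin).exists
  exact ⟨δ, h2, h1⟩

theorem TopRokhlinDimLE.of_approximateSubgroups {Γ X : Type*} [Group Γ] [Countable Γ]
    [MetricSpace X] [CompactSpace X] [Nonempty X] [MulAction Γ X] [ContinuousConstSMul Γ X]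
    (hfree : IsFreeAction Γ X) {d : ℕ} (hX : CoveringDimLE X d) {F : ℕ → Set Γ} {L : ℕ}
    (hF : IsFolnerSequence F) (hFL : ∀ n, IsApproximateSubgroup (L : ℝ) (F n)) :
    TopRokhlinDimLE Γ X ((d + 1) * ((L ^ 8 + 1) * L) - 1) := by
  have hL : 0 < L := by exact_mod_cast zero_lt_one.trans_le (hFL 0).one_le
  refine topRokhlinDimLE_of_open_towers (I := Fin (d + 1) × Fin (L ^ 8 + 1) × Fin L) ?_ hF
    fun n => ?_
  · have : 0 < (d + 1) * ((L ^ 8 + 1) * L) := by positivity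
    simp only [Fintype.card_prod, Fintype.card_fin]
    omega
  classical
  obtain ⟨δ, hδ, hdisp⟩ := hfree.exists_displacement (X := X) (P := F n ^ 8) (by
      have := ((hF.finite n).toFinset ^ 8).finite_toSet
      rwa [Finset.coe_pow, Set.Finite.coe_toFinset] at this)
  obtain ⟨T, -, hT⟩ := isCompact_univ.elim_finite_subcover_image (b := Set.univ)
    (c := fun p : X => Metric.ball p (δ / 8)) (fun p _ => Metric.isOpen_ball)
    (fun x _ => by simpa using ⟨x, by simpa using hδ⟩)
  obtain ⟨hTfin, hTX⟩ := hT
  have : Finite T := hTfin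
  -- With error below `δ / 8`, the perturbed bump is positive on the `δ / 8`-ball and only within `δ
  -- / 2` of `p`. So the positivity sets cover, and no nontrivial element of `F n ^ 8` returns a
  -- point to the same one.
  obtain ⟨φ, hφ, hgen⟩ := hX.exists_near_generalPosition (Γ := Γ)
    (fun p : T => (⟨fun x => δ / 4 - dist x p, by fun_prop⟩ : C(X, ℝ)))
    (show 0 < δ / 8 by positivity)
  let Z : Fin (d + 1) → Set X := fun s => {x | ∀ (g : Γ) (p : T), φ s p (g • x) ≠ 0}
  have hZ : ∀ s, ∀ g : Γ, ∀ x ∈ Z s, g • x ∈ Z s := by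
    intro s g x hx g' p
    rw [smul_smul]
    exact hx _ p
  have hZX : ∀ x, ∃ s, x ∈ Z s := by
    intro x
    by_contra! h
    simp only [Z, Set.mem_ofPred_eq, not_forall, not_not] at h
    choose g p hgp using h
    obtain ⟨s, hs⟩ := hgen g p x
    exact hs (hgp s)
  have htow := fun s => (isInvariantSetAlgebra_disjoint_frontier (hZ s)).exists_towers hfree
    (hF.finite n) (hFL n) (fun p : T => {x | 0 < φ s p x}) (fun p => by
      refine Set.disjoint_left.2 fun x hx hxZ => ?_
      have h0 : 0 = φ s p x := frontier_lt_subset_eq continuous_const (φ s p).continuous hx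
      refine hxZ 1 p ?_
      rw [one_smul, ← h0]) (fun p g hg a ha hga => by
      by_contra hne
      have hg1 : g ≠ 1 := by
        rintro rfl
        exact hne (one_smul _ a)
      have hnear : ∀ x, 0 < φ s p x → dist x p < δ / 2 := by
        intro x hx
        have := hφ s p x
        rw [Real.dist_eq, abs_lt] at this
        simp only [ContinuousMap.coe_mk] at this
        linarith
      have h1 := hnear a ha
      have h2 := hnear (g • a) hga
      have h3 := dist_triangle_right (g • a) a p
      linarith [hdisp g hg hg1 a]) (by
      refine Set.eq_univ_of_forall fun x => ?_
      obtain ⟨p, hp, hxp⟩ := Set.mem_iUnion₂.1 (hTX (Set.mem_univ x))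
      refine Set.mem_iUnion.2 ⟨⟨p, hp⟩, ?_⟩
      have := hφ s ⟨p, hp⟩ x
      rw [Real.dist_eq, abs_lt] at this
      simp only [ContinuousMap.coe_mk] at this
      rw [Metric.mem_ball] at hxp
      change 0 < φ s ⟨p, hp⟩ x
      linarith)
  choose U hUC hUd hUX using htow
  refine ⟨fun q => interior (U q.1 q.2), fun q => isOpen_interior, fun q => ?_, fun x => ?_⟩
  · exact (hUd q.1 q.2).mono_on fun g _ => Set.smul_set_mono interior_subset
  · obtain ⟨s, hs⟩ := hZX x
    obtain ⟨q, g, hg, y, hy, rfl⟩ := hUX s x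
    refine ⟨(s, q), g, hg, Set.smul_mem_smul_set ?_⟩
    have hyZ : y ∈ Z s := by
      have := hZ s g⁻¹ _ hs
      simpa using this
    -- On `Z s` a set of the algebra coincides with its interior.
    have hyf := Set.disjoint_right.1 (hUC s q) hyZ
    by_contra hyi
    exact hyf ⟨subset_closure hy, hyi⟩

/-! ### Følner sequences of approximate subgroups -/

/-- The group has a Følner sequence that consists of approximate subgroups with a common
constant. -/
def HasApproximateSubgroupFolner (G : Type*) [Group G] : Prop :=
  ∃ (F : ℕ → Set G) (L : ℕ), IsFolnerSequence F ∧ ∀ n, IsApproximateSubgroup (L : ℝ) (F n)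

theorem HasSymmetricWAFC.hasApproximateSubgroupFolner {G : Type*} [Group G]
    (h : HasSymmetricWAFC G) : HasApproximateSubgroupFolner G := by
  classical
  obtain ⟨F, L, hsymm, hF⟩ := h
  refine ⟨F, L, hF.folner, fun n => ⟨hF.folner.one_mem n, hsymm n, ?_⟩⟩
  obtain ⟨k, hk, hA⟩ := hF.approx n
  obtain ⟨g, hg⟩ := hA.cover
  refine ⟨Finset.univ.image g, ?_, ?_⟩
  · have := (Finset.card_image_le (s := Finset.univ) (f := g)).trans (by simpa using hk)
    exact_mod_cast this
  · rw [sq]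
    nth_rewrite 1 [← hsymm n]
    intro x hx
    obtain ⟨i, hi⟩ := Set.mem_iUnion.1 (hg hx)
    obtain ⟨a, ha, rfl⟩ := hi
    exact Set.smul_mem_smul (by simp) ha

theorem IsApproximateSubgroup.prod {G H : Type*} [Group G] [Group H] {K L : ℝ} {A : Set G}
    {B : Set H} (hA : IsApproximateSubgroup K A) (hB : IsApproximateSubgroup L B) :
    IsApproximateSubgroup (K * L) (A ×ˢ B) where
  one_mem := ⟨hA.one_mem, hB.one_mem⟩
  inv_eq_self := by rw [Set.inv_prod, hA.inv_eq_self, hB.inv_eq_self]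
  sq_covBySMul := by
    obtain ⟨S, hS, hAS⟩ := hA.sq_covBySMul
    obtain ⟨T, hT, hBT⟩ := hB.sq_covBySMul
    refine ⟨S ×ˢ T, ?_, ?_⟩
    · rw [Finset.card_product, Nat.cast_mul]
      exact mul_le_mul hS hT (Nat.cast_nonneg _) ((Nat.cast_nonneg _).trans hS)
    · rintro ⟨x, y⟩ h
      rw [sq] at h
      obtain ⟨⟨a, b⟩, ⟨ha, hb⟩, ⟨a', b'⟩, ⟨ha', hb'⟩, h⟩ := h
      obtain ⟨rfl, rfl⟩ := Prod.mk.inj h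
      obtain ⟨s, hs, c, hc, hsc⟩ := hAS (by rw [sq]; exact Set.mul_mem_mul ha ha')
      obtain ⟨t, ht, d, hd, htd⟩ := hBT (by rw [sq]; exact Set.mul_mem_mul hb hb')
      exact ⟨(s, t), by simpa using ⟨hs, ht⟩, (c, d), ⟨hc, hd⟩, Prod.ext hsc htd⟩

theorem IsFolnerSequence.ncard_pos {G : Type*} [Group G] {F : ℕ → Set G}
    (hF : IsFolnerSequence F) (n : ℕ) : 0 < (F n).ncard :=
  (Set.ncard_pos (hF.finite n)).2 ⟨1, hF.one_mem n⟩

theorem IsFolnerSequence.prod {G H : Type*} [Group G] [Group H] {A : ℕ → Set G} {B : ℕ → Set H}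
    (hA : IsFolnerSequence A) (hB : IsFolnerSequence B) :
    IsFolnerSequence (fun n => A n ×ˢ B n) where
  finite n := (hA.finite n).prod (hB.finite n)
  one_mem n := ⟨hA.one_mem n, hB.one_mem n⟩
  monotone _ _ h := Set.prod_mono (hA.monotone h) (hB.monotone h)
  iUnion_eq := by
    rw [Set.iUnion_prod_of_monotone hA.monotone hB.monotone, hA.iUnion_eq, hB.iUnion_eq,
      Set.univ_prod_univ]
  tendsto := by
    rintro ⟨g, h⟩
    have hlim := (hA.tendsto g).add (hB.tendsto h)
    rw [add_zero] at hlim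
    refine squeeze_zero (fun n => by positivity) (fun n => ?_) hlim
    have ha : (0 : ℝ) < (A n).ncard := by exact_mod_cast hA.ncard_pos n
    have hb : (0 : ℝ) < (B n).ncard := by exact_mod_cast hB.ncard_pos n
    -- The change is made in one factor at a time.
    have hsub : ((g, h) • (A n ×ˢ B n)) ∆ (A n ×ˢ B n) ⊆
        ((g • A n) ∆ A n) ×ˢ (h • B n) ∪ A n ×ˢ ((h • B n) ∆ B n) := by
      rintro ⟨x, y⟩ hxy
      simp only [Set.mem_symmDiff, Set.mem_smul_set_iff_inv_smul_mem, Set.mem_union, Set.mem_prod,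
        Prod.inv_mk] at hxy ⊢
      tauto
    have hfin : (((g • A n) ∆ A n) ×ˢ (h • B n) ∪ A n ×ˢ ((h • B n) ∆ B n)).Finite :=
      ((((hA.finite n).smul_set).symmDiff (hA.finite n)).prod (hB.finite n).smul_set).union
        ((hA.finite n).prod ((hB.finite n).smul_set.symmDiff (hB.finite n)))
    have hle := (Set.ncard_le_ncard hsub hfin).trans (Set.ncard_union_le _ _)
    rw [Set.ncard_prod, Set.ncard_prod, Set.ncard_smul_set] at hle
    rw [Set.ncard_prod, Nat.cast_mul, div_add_div _ _ ha.ne' hb.ne']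
    gcongr
    exact_mod_cast hle

theorem HasApproximateSubgroupFolner.prod {G H : Type*} [Group G] [Group H]
    (hG : HasApproximateSubgroupFolner G) (hH : HasApproximateSubgroupFolner H) :
    HasApproximateSubgroupFolner (G × H) := by
  obtain ⟨A, K, hA, hAK⟩ := hG
  obtain ⟨B, L, hB, hBL⟩ := hH
  refine ⟨_, K * L, hA.prod hB, fun n => ?_⟩
  rw [Nat.cast_mul]
  exact (hAK n).prod (hBL n)

theorem HasApproximateSubgroupFolner.of_mulEquiv {G H : Type*} [Group G] [Group H] (e : G ≃* H)
    (hG : HasApproximateSubgroupFolner G) : HasApproximateSubgroupFolner H := by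
  obtain ⟨F, L, hF, hL⟩ := hG
  refine ⟨fun n => e '' F n, L, ⟨fun n => (hF.finite n).image e, fun n => ⟨1, hF.one_mem n, map_one e⟩,
    fun _ _ h => Set.image_mono (hF.monotone h), ?_, fun g => ?_⟩, fun n => (hL n).image e⟩
  · rw [← Set.image_iUnion, hF.iUnion_eq, Set.image_univ_of_surjective e.surjective]
  · have h : ∀ n, g • (e '' F n) = e '' (e.symm g • F n) := by
      intro n
      rw [Set.image_smul_distrib, MulEquiv.apply_symm_apply]
    simp only [h, ← Set.image_symmDiff e.injective, Set.ncard_image_of_injective _ e.injective]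
    exact hF.tendsto _

/-- Finite subgroups generated by initial segments of an enumeration have constant 1, and `g • H n =
H n` once `g` lies in `H n`. -/
theorem IsLocallyFiniteGroup.hasApproximateSubgroupFolner {G : Type*} [Group G] [Countable G]
    (hG : IsLocallyFiniteGroup G) : HasApproximateSubgroupFolner G := by
  obtain ⟨f, hf⟩ := exists_surjective_nat G
  let H : ℕ → Subgroup G := fun n => Subgroup.closure (f '' Set.Iic n)
  have hmono : Monotone H := fun m n h =>
    Subgroup.closure_mono (Set.image_mono (Set.Iic_subset_Iic.2 h))
  have hmem : ∀ g, ∃ n, g ∈ H n := fun g => by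
    obtain ⟨n, rfl⟩ := hf g
    exact ⟨n, Subgroup.subset_closure ⟨n, Set.self_mem_Iic, rfl⟩⟩
  refine ⟨fun n => (H n : Set G), 1, ⟨fun n => ?_, fun n => one_mem _, fun m n h => hmono h, ?_,
    fun g => ?_⟩, fun n => by simp⟩
  · have : Finite (H n) := hG (H n)
      ((Subgroup.fg_iff _).2 ⟨_, rfl, (Set.finite_Iic n).image f⟩)
    exact Set.toFinite _
  · refine Set.eq_univ_of_forall fun g => ?_
    obtain ⟨n, hn⟩ := hmem g
    exact Set.mem_iUnion.2 ⟨n, hn⟩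
  · obtain ⟨m, hm⟩ := hmem g
    refine tendsto_const_nhds.congr' ?_
    filter_upwards [eventually_ge_atTop m] with n hn
    rw [smul_coe_set (hmono hn hm)]
    simp

/-! ### Growth criterion and finitely generated abelian groups -/

/-- A sequence of finite sets with subexponential growth that absorbs left translations is a
Følner sequence. -/
theorem isFolnerSequence_of_growth {G : Type*} [Group G] {F : ℕ → Set G}
    (hfin : ∀ n, (F n).Finite) (hone : ∀ n, 1 ∈ F n) (hmono : Monotone F)
    (hsmul : ∀ g : G, ∃ c, ∀ n, g • F n ⊆ F (n + c))
    (hgrow : ∀ c, Tendsto (fun n => ((F (n + c)).ncard : ℝ) / (F n).ncard) atTop (𝓝 1)) :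
    IsFolnerSequence F where
  finite := hfin
  one_mem := hone
  monotone := hmono
  iUnion_eq := by
    refine Set.eq_univ_of_forall fun g => ?_
    obtain ⟨c, hc⟩ := hsmul g
    exact Set.mem_iUnion.2 ⟨0 + c, hc 0 ⟨1, hone 0, mul_one g⟩⟩
  tendsto g := by
    obtain ⟨c, hc⟩ := hsmul g
    have hlim : Tendsto (fun n => 2 * (((F (n + c)).ncard : ℝ) / (F n).ncard - 1)) atTop (𝓝 0) := by
      simpa using ((hgrow c).sub_const 1).const_mul 2
    refine squeeze_zero (fun n => by positivity) (fun n => ?_) hlim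
    have hpos : (0 : ℝ) < (F n).ncard := by
      exact_mod_cast (Set.ncard_pos (hfin n)).2 ⟨1, hone n⟩
    -- Both `g • F n` and `F n` lie in `F (n + c)`, so each half of the symmetric difference has at
    -- most `|F (n + c)| - |F n|` elements.
    have h1 : ((g • F n) \ F n).ncard + (F n).ncard ≤ (F (n + c)).ncard := by
      rw [Set.ncard_sdiff_add_ncard _ _ (hfin n).smul_set (hfin n)]
      exact Set.ncard_le_ncard (Set.union_subset (hc n) (hmono (Nat.le_add_right _ _))) (hfin _)
    have h2 : (F n \ (g • F n)).ncard + (F n).ncard ≤ (F (n + c)).ncard := by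
      have h := Set.ncard_sdiff_add_ncard (F n) (g • F n) (hfin n) (hfin n).smul_set
      rw [Set.ncard_smul_set] at h
      rw [h]
      exact Set.ncard_le_ncard (Set.union_subset (hmono (Nat.le_add_right _ _)) (hc n)) (hfin _)
    have h3 : ((g • F n) ∆ F n).ncard ≤ _ := Set.ncard_union_le _ _
    have h4 : (((g • F n) ∆ F n).ncard : ℝ) ≤ 2 * ((F (n + c)).ncard - (F n).ncard) := by
      have h1' : ((((g • F n) \ F n).ncard : ℝ)) + (F n).ncard ≤ (F (n + c)).ncard := by
        exact_mod_cast h1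
      have h2' : (((F n \ (g • F n)).ncard : ℝ)) + (F n).ncard ≤ (F (n + c)).ncard := by
        exact_mod_cast h2
      have h3' : (((g • F n) ∆ F n).ncard : ℝ) ≤
        ((g • F n) \ F n).ncard + (F n \ (g • F n)).ncard := by exact_mod_cast h3
      linarith
    rw [div_le_iff₀ hpos]
    calc _ ≤ _ := h4
      _ = _ := by field_simp

/-- Sequences squeezed between asymptotically equal bounds have subexponential growth. -/
theorem tendsto_growth_of_bounds {N : ℕ → ℕ} {a b : ℕ → ℝ} (ha : ∀ n, 1 ≤ n → 0 < a n)
    (haN : ∀ n, a n ≤ N n) (hNb : ∀ n, N n ≤ b n) (hN : Monotone N) {c : ℕ}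
    (hab : Tendsto (fun n => b (n + c) / a n) atTop (𝓝 1)) :
    Tendsto (fun n => (N (n + c) : ℝ) / N n) atTop (𝓝 1) := by
  refine tendsto_of_tendsto_of_tendsto_of_le_of_le' tendsto_const_nhds hab ?_ ?_
  · filter_upwards [eventually_ge_atTop 1] with n hn
    rw [one_le_div ((ha n hn).trans_le (haN n))]
    exact_mod_cast hN (Nat.le_add_right _ _)
  · filter_upwards [eventually_ge_atTop 1] with n hn
    have := ha n hn
    exact div_le_div₀ ((Nat.cast_nonneg _).trans (hNb _)) (hNb _) this (haN n)

theorem tendsto_two_mul_add_one_shift (c : ℕ) :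
    Tendsto (fun k : ℕ => (2 * ((k + c : ℕ) : ℝ) + 1) / (2 * k + 1)) atTop (𝓝 1) := by
  have h : Tendsto (fun k : ℕ => 2 * (c : ℝ) / (2 * k + 1) + 1) atTop (𝓝 1) := by
    simpa using (Tendsto.const_div_atTop (tendsto_atTop_add_const_right _ (1 : ℝ)
      ((tendsto_natCast_atTop_atTop (R := ℝ)).const_mul_atTop two_pos)) (2 * (c : ℝ))).add_const 1
  refine h.congr fun k => ?_
  have : (2 * (k : ℝ) + 1) ≠ 0 := by positivity
  push_cast
  field_simp
  ring

theorem tendsto_sq_add_one_shift (c : ℕ) :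
    Tendsto (fun k : ℕ => (((k + c : ℕ) : ℝ) ^ 2 + 1) / (k : ℝ) ^ 2) atTop (𝓝 1) := by
  have h0 : Tendsto (fun k : ℕ => (1 : ℝ) / k) atTop (𝓝 0) := tendsto_one_div_atTop_nhds_zero_nat
  have h : Tendsto (fun k : ℕ => (1 + c * ((1 : ℝ) / k)) ^ 2 + ((1 : ℝ) / k) ^ 2) atTop (𝓝 1) := by
    simpa using (((h0.const_mul (c : ℝ)).const_add 1).pow 2).add (h0.pow 2)
  refine h.congr' ?_
  filter_upwards [eventually_ge_atTop 1] with k hk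
  have : (k : ℝ) ≠ 0 := by positivity
  push_cast
  field_simp

theorem ncard_integer_box (ι : Type*) [Fintype ι] (k : ℕ) :
    {f : ι → ℤ | ∀ i, |f i| ≤ k}.ncard = (2 * k + 1) ^ Fintype.card ι := by
  classical
  have h : {f : ι → ℤ | ∀ i, |f i| ≤ k} =
      ((Finset.Icc (fun _ => -(k : ℤ)) (fun _ => (k : ℤ)) : Finset (ι → ℤ)) : Set (ι → ℤ)) := by
    ext f
    simp [abs_le, Pi.le_def, forall_and]
  rw [h, Set.ncard_coe_finset, Pi.card_Icc]
  simp only [Int.card_Icc, Finset.prod_const, Finset.card_univ]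
  congr 1
  omega

theorem finite_integer_box (ι : Type*) [Fintype ι] (k : ℕ) :
    {f : ι → ℤ | ∀ i, |f i| ≤ k}.Finite := by
  refine Set.finite_of_ncard_pos ?_
  rw [ncard_integer_box]
  positivity

theorem exists_sign_abs_sub_le {x k : ℤ} (hx : |x| ≤ 2 * k) :
    ∃ s : Bool, |x - bif s then k else -k| ≤ k := by
  rw [abs_le] at hx
  rcases le_total 0 x with h | h
  · exact ⟨true, by rw [cond_true, abs_le]; omega⟩
  · exact ⟨false, by rw [cond_false, abs_le]; omega⟩

/-- Cubes work: a sum of two points of the cube of size `k` returns to it after a shift by `k` or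
`-k` in each coordinate, which gives the constant `2 ^ |ι|`. -/
theorem hasApproximateSubgroupFolner_pi_int (ι : Type*) [Fintype ι] :
    HasApproximateSubgroupFolner (ι → Multiplicative ℤ) := by
  classical
  let F : ℕ → Set (ι → Multiplicative ℤ) := fun k => {f | ∀ i, |(f i).toAdd| ≤ k}
  have hcard : ∀ k, (F k).ncard = (2 * k + 1) ^ Fintype.card ι := ncard_integer_box ι
  have hfin : ∀ k, (F k).Finite := finite_integer_box ι
  have hone : ∀ k, 1 ∈ F k := fun k i => by simp
  have hmono : Monotone F := fun k l h f hf i => (hf i).trans (by exact_mod_cast h)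
  refine ⟨F, (Finset.univ : Finset (ι → Bool)).card,
    isFolnerSequence_of_growth hfin hone hmono (fun g => ?_) (fun c => ?_), fun k => ?_⟩
  · refine ⟨∑ i, (g i).toAdd.natAbs, fun n => ?_⟩
    rintro _ ⟨f, hf, rfl⟩ i
    have h1 : (g i).toAdd.natAbs ≤ ∑ i, (g i).toAdd.natAbs :=
      Finset.single_le_sum (f := fun i => (g i).toAdd.natAbs) (fun _ _ => Nat.zero_le _)
        (Finset.mem_univ i)
    have h2 := hf i
    have h3 := abs_add_le (g i).toAdd (f i).toAdd
    have h4 : |(g i).toAdd| ≤ ((∑ i, (g i).toAdd.natAbs : ℕ) : ℤ) := by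
      rw [Int.abs_eq_natAbs]; exact_mod_cast h1
    change |(g i).toAdd + (f i).toAdd| ≤ ((n + ∑ i, (g i).toAdd.natAbs : ℕ) : ℤ)
    push_cast at h4 ⊢
    linarith
  · simp only [hcard]
    push_cast
    simpa [div_pow] using (tendsto_two_mul_add_one_shift c).pow (Fintype.card ι)
  · refine ⟨hone k, ?_, ?_⟩
    · ext f
      simp [F]
    · refine ⟨Finset.univ.image (fun s : ι → Bool => fun i =>
        Multiplicative.ofAdd (bif s i then (k : ℤ) else -k)), ?_, ?_⟩
      · exact_mod_cast Finset.card_image_le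
      · intro h hh
        rw [sq] at hh
        obtain ⟨f, hf, f', hf', rfl⟩ := hh
        have hs : ∀ i, ∃ s : Bool, |(f i).toAdd + (f' i).toAdd - bif s then (k : ℤ) else -k| ≤ k :=
          fun i => exists_sign_abs_sub_le (by
            have h1 := hf i
            have h2 := hf' i
            have h3 := abs_add_le (f i).toAdd (f' i).toAdd
            linarith)
        choose s hs using hs
        refine ⟨fun i => Multiplicative.ofAdd (bif s i then (k : ℤ) else -k), by simp,
          (fun i => Multiplicative.ofAdd (bif s i then (k : ℤ) else -k))⁻¹ * (f * f'), ?_, ?_⟩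
        · intro i
          refine le_of_eq_of_le (congrArg abs ?_) (hs i)
          simp only [Pi.mul_apply, Pi.inv_apply, toAdd_mul, toAdd_inv, toAdd_ofAdd]
          ring
        · exact mul_inv_cancel_left _ _

theorem hasApproximateSubgroupFolner_of_comm_of_fg {G : Type*} [Group G]
    (hcomm : ∀ a b : G, a * b = b * a) (hfg : Group.FG G) : HasApproximateSubgroupFolner G := by
  let _ : CommGroup G := { ‹Group G› with mul_comm := hcomm }
  obtain ⟨ι, j, _, _, p, hp, e, ⟨φ⟩⟩ := CommGroup.equiv_free_prod_prod_multiplicative_zmod G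
  have : ∀ i, NeZero (p i ^ e i) := fun i => ⟨pow_ne_zero _ (hp i).ne_zero⟩
  have : ∀ i, Finite (Multiplicative (ZMod (p i ^ e i))) := fun i =>
    inferInstanceAs (Finite (ZMod (p i ^ e i)))
  refine HasApproximateSubgroupFolner.of_mulEquiv φ.symm
    ((hasApproximateSubgroupFolner_pi_int j).prod ?_)
  exact IsLocallyFiniteGroup.hasApproximateSubgroupFolner fun H _ => inferInstance

/-! ### Boxes in the Heisenberg group -/

theorem abs_dotProduct_le {n : ℕ} {u v : Fin n → ℤ} {A B : ℤ} (hu : ∀ i, |u i| ≤ A)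
    (hv : ∀ i, |v i| ≤ B) : |u ⬝ᵥ v| ≤ n * (A * B) := by
  calc |u ⬝ᵥ v| ≤ ∑ i, |u i * v i| := Finset.abs_sum_le_sum_abs _ _
    _ ≤ ∑ _i : Fin n, A * B := Finset.sum_le_sum fun i _ => by
        rw [abs_mul]
        exact mul_le_mul (hu i) (hv i) (abs_nonneg _) ((abs_nonneg _).trans (hu i))
    _ = n * (A * B) := by simp

namespace Heisenberg

variable {n : ℕ}

/-- Twice the central coordinate in exponential coordinates. -/
def w (h : Heisenberg n) : ℤ := 2 * h.z - h.x ⬝ᵥ h.y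

theorem w_inv (h : Heisenberg n) : h⁻¹.w = -h.w := by
  simp [w]
  ring

/-- The cocycle becomes skew-symmetric in this coordinate, which is what makes inversion a sign
change and the boxes symmetric. -/
theorem w_mul (g h : Heisenberg n) : (g * h).w = g.w + h.w + (g.x ⬝ᵥ h.y - h.x ⬝ᵥ g.y) := by
  simp only [w, mul_x, mul_y, mul_z, add_dotProduct, dotProduct_add]
  ring

/-- The box of size `k` in exponential coordinates. -/
def box (n k : ℕ) : Set (Heisenberg n) :=
  {h | (∀ i, |h.x i| ≤ k) ∧ (∀ i, |h.y i| ≤ k) ∧ |h.w| ≤ (k : ℤ) ^ 2}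

theorem one_mem_box (n k : ℕ) : 1 ∈ box n k := by simp [box, w]

theorem box_inv (n k : ℕ) : (box n k)⁻¹ = box n k := by
  ext h
  simp [box, w_inv]

theorem box_mono (n : ℕ) : Monotone (box n) := by
  rintro k l h g ⟨hx, hy, hw⟩
  have hkl : (k : ℤ) ≤ l := by exact_mod_cast h
  exact ⟨fun i => (hx i).trans hkl, fun i => (hy i).trans hkl, hw.trans (by gcongr)⟩

/-- Coordinates that count up from the bottom of a box. -/
def boxParam (n k : ℕ) (q : (Fin n → ℤ) × (Fin n → ℤ) × ℤ) : Heisenberg n :=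
  ⟨q.1, q.2.1, (q.1 ⬝ᵥ q.2.1 - (k : ℤ) ^ 2 + 1) / 2 + q.2.2⟩

theorem boxParam_injective (n k : ℕ) : Function.Injective (boxParam n k) := by
  rintro ⟨x, y, m⟩ ⟨x', y', m'⟩ h
  simp only [boxParam, Heisenberg.mk.injEq] at h
  obtain ⟨rfl, rfl, h⟩ := h
  simpa using h

/-- The parameters with `M` possible central coordinates. -/
def boxDomain (n k M : ℕ) : Set ((Fin n → ℤ) × (Fin n → ℤ) × ℤ) :=
  {f | ∀ i, |f i| ≤ (k : ℤ)} ×ˢ {f | ∀ i, |f i| ≤ (k : ℤ)} ×ˢ Set.Ico 0 (M : ℤ)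

theorem ncard_boxDomain (n k M : ℕ) :
    (boxDomain n k M).ncard = (2 * k + 1) ^ n * ((2 * k + 1) ^ n * M) := by
  have h : (Set.Ico 0 (M : ℤ)).ncard = M := by
    rw [← Finset.coe_Ico, Set.ncard_coe_finset]
    simp
  rw [boxDomain, Set.ncard_prod, Set.ncard_prod, ncard_integer_box, Fintype.card_fin, h]

theorem finite_boxDomain (n k M : ℕ) : (boxDomain n k M).Finite :=
  (finite_integer_box _ _).prod ((finite_integer_box _ _).prod (Set.finite_Ico _ _))

/-- Since `w` has the parity of `x ⬝ᵥ y`, the fibre of the box over `(x, y)` has `k ^ 2` or `k ^ 2 +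
1` points. The two bounds on the cardinality are asymptotically equal. -/
theorem image_boxDomain_subset_box (n k : ℕ) : boxParam n k '' boxDomain n k (k ^ 2) ⊆ box n k := by
  rintro _ ⟨⟨x, y, m⟩, ⟨hx, hy, hm⟩, rfl⟩
  refine ⟨hx, hy, ?_⟩
  simp only [Set.mem_Ico, Nat.cast_pow] at hm
  simp only [w, boxParam]
  rw [abs_le]
  omega

theorem box_subset_image_boxDomain (n k : ℕ) :
    box n k ⊆ boxParam n k '' boxDomain n k (k ^ 2 + 1) := by
  rintro ⟨x, y, z⟩ ⟨hx, hy, hw⟩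
  simp only [w, abs_le] at hw
  refine ⟨(x, y, z - (x ⬝ᵥ y - (k : ℤ) ^ 2 + 1) / 2), ⟨hx, hy, ?_⟩, ?_⟩
  · simp only [Set.mem_Ico, Nat.cast_add, Nat.cast_pow, Nat.cast_one]
    omega
  · simp [boxParam]

theorem finite_box (n k : ℕ) : (box n k).Finite :=
  ((finite_boxDomain _ _ _).image _).subset (box_subset_image_boxDomain n k)

theorem le_ncard_box (n k : ℕ) :
    (2 * k + 1) ^ n * ((2 * k + 1) ^ n * k ^ 2) ≤ (box n k).ncard := by
  rw [← ncard_boxDomain, ← Set.ncard_image_of_injective _ (boxParam_injective n k)]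
  exact Set.ncard_le_ncard (image_boxDomain_subset_box n k) (finite_box n k)

theorem ncard_box_le (n k : ℕ) :
    (box n k).ncard ≤ (2 * k + 1) ^ n * ((2 * k + 1) ^ n * (k ^ 2 + 1)) := by
  rw [← ncard_boxDomain, ← Set.ncard_image_of_injective _ (boxParam_injective n k)]
  exact Set.ncard_le_ncard (box_subset_image_boxDomain n k) ((finite_boxDomain _ _ _).image _)

theorem smul_box_subset (g : Heisenberg n) : ∃ c, ∀ k, g • box n k ⊆ box n (k + c) := by
  let C : ℕ := ∑ i, (g.x i).natAbs + ∑ i, (g.y i).natAbs + g.w.natAbs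
  have hx : ∀ i, |g.x i| ≤ (C : ℤ) := fun i => by
    have := Finset.single_le_sum (f := fun i => (g.x i).natAbs) (fun _ _ => Nat.zero_le _)
        (Finset.mem_univ i)
    rw [Int.abs_eq_natAbs]
    exact_mod_cast this.trans (by omega)
  have hy : ∀ i, |g.y i| ≤ (C : ℤ) := fun i => by
    have := Finset.single_le_sum (f := fun i => (g.y i).natAbs) (fun _ _ => Nat.zero_le _)
        (Finset.mem_univ i)
    rw [Int.abs_eq_natAbs]
    exact_mod_cast this.trans (by omega)
  have hw : |g.w| ≤ (C : ℤ) := by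
    rw [Int.abs_eq_natAbs]
    exact_mod_cast (by omega)
  -- Translation changes `w` by at most `C + 2 * n * C * k`; the terms `c ^ 2` and `2 * k * c` of
  -- `(k + c) ^ 2` absorb this for `c = C * (n + 1)`.
  refine ⟨C * (n + 1), fun k => ?_⟩
  rintro _ ⟨h, ⟨hhx, hhy, hhw⟩, rfl⟩
  have hC : (0 : ℤ) ≤ C := Nat.cast_nonneg _
  have hn : (0 : ℤ) ≤ n := Nat.cast_nonneg _
  have hk : (0 : ℤ) ≤ k := Nat.cast_nonneg _
  have hCn : (C : ℤ) ≤ C * (n + 1) := le_mul_of_one_le_right hC (by linarith)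
  refine ⟨fun i => ?_, fun i => ?_, ?_⟩
  · refine (abs_add_le (g.x i) (h.x i)).trans ?_
    push_cast
    linarith [hx i, hhx i]
  · refine (abs_add_le (g.y i) (h.y i)).trans ?_
    push_cast
    linarith [hy i, hhy i]
  · change |(g * h).w| ≤ _
    rw [w_mul]
    have h1 := abs_le.1 (abs_dotProduct_le hx hhy)
    have h2 := abs_le.1 (abs_dotProduct_le hhx hy)
    have h3 := abs_le.1 hw
    have h4 := abs_le.1 hhw
    have h5 : (C : ℤ) ≤ (C * (n + 1)) ^ 2 := by
      have h6 : (C : ℤ) ≤ C ^ 2 := by exact_mod_cast Nat.le_self_pow two_ne_zero C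
      exact h6.trans (by gcongr)
    have h7 : (n : ℤ) * (C * k) ≤ k * (C * (n + 1)) := by nlinarith [mul_nonneg hC hk]
    push_cast
    rw [abs_le]
    constructor <;> nlinarith

theorem isFolnerSequence_box (n : ℕ) : IsFolnerSequence (box n) := by
  refine isFolnerSequence_of_growth (finite_box n) (one_mem_box n) (box_mono n) smul_box_subset
    fun c => ?_
  refine tendsto_growth_of_bounds (N := fun k => (box n k).ncard)
    (a := fun k => (2 * (k : ℝ) + 1) ^ n * ((2 * k + 1) ^ n * k ^ 2))
    (b := fun k => (2 * (k : ℝ) + 1) ^ n * ((2 * k + 1) ^ n * (k ^ 2 + 1)))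
    (fun k hk => by positivity) (fun k => by exact_mod_cast le_ncard_box n k)
    (fun k => by exact_mod_cast ncard_box_le n k)
    (fun k l h => Set.ncard_le_ncard (box_mono n h) (finite_box n l)) ?_
  have h := tendsto_two_mul_add_one_shift c
  have := (h.pow n).mul ((h.pow n).mul (tendsto_sq_add_one_shift c))
  simpa only [div_pow, div_mul_div_comm, one_pow, one_mul] using this

theorem exists_approx_multiple {R K M : ℤ} (hK : 0 ≤ K) (hM : 0 ≤ M) (hR : |R| ≤ M * K) :
    ∃ m : ℤ, |m| ≤ M + 1 ∧ |R - 2 * (m * K)| ≤ K := by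
  rcases hK.eq_or_lt with rfl | hK
  · exact ⟨0, by simp; omega, by simpa using hR⟩
  · refine ⟨(R + K) / (2 * K), ?_, ?_⟩
    · rw [abs_le] at hR ⊢
      constructor
      · rw [Int.le_ediv_iff_mul_le (by positivity)]
        nlinarith
      · refine Int.ediv_le_of_le_mul (by positivity) ?_
        nlinarith
    · have h1 := Int.emod_add_mul_ediv (R + K) (2 * K)
      have h2 := Int.emod_nonneg (R + K) (show 2 * K ≠ 0 by positivity)
      have h3 := Int.emod_lt_of_pos (R + K) (show 0 < 2 * K by positivity)
      rw [abs_le]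
      constructor <;> nlinarith

/-- The translation with signs `q.1`, `q.2.1` and central coordinate `q.2.2` in units of a box. -/
def boxShift (n k : ℕ) (q : (Fin n → Bool) × (Fin n → Bool) × ℤ) : Heisenberg n :=
  ⟨fun i => bif q.1 i then (k : ℤ) else -k, fun i => bif q.2.1 i then (k : ℤ) else -k,
    q.2.2 * k ^ 2⟩

/-- Signs bring `x` and `y` back into the box. The remaining central error is a bounded multiple of
`k ^ 2`, removed by a central shift by `m * k ^ 2`, so the constant does not depend on `k`. -/
theorem isApproximateSubgroup_box (n k : ℕ) :
    IsApproximateSubgroup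
      (((Finset.univ : Finset (Fin n → Bool)) ×ˢ (Finset.univ : Finset (Fin n → Bool)) ×ˢ
        Finset.Icc (-(7 * n + 3 : ℤ)) (7 * n + 3)).card : ℝ) (box n k) := by
  classical
  refine ⟨one_mem_box n k, box_inv n k, Finset.image (boxShift n k) _,
    Nat.cast_le.2 Finset.card_image_le, ?_⟩
  intro h hh
  rw [sq] at hh
  obtain ⟨f, ⟨hfx, hfy, hfw⟩, g, ⟨hgx, hgy, hgw⟩, rfl⟩ := hh
  generalize hp : f * g = p
  have hk : (0 : ℤ) ≤ k := Nat.cast_nonneg _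
  have hpx : ∀ i, |p.x i| ≤ 2 * k := fun i => by
    have := abs_add_le (f.x i) (g.x i)
    rw [← hp, mul_x, Pi.add_apply]
    linarith [hfx i, hgx i]
  have hpy : ∀ i, |p.y i| ≤ 2 * k := fun i => by
    have := abs_add_le (f.y i) (g.y i)
    rw [← hp, mul_y, Pi.add_apply]
    linarith [hfy i, hgy i]
  have hpw : |p.w| ≤ (2 * n + 2) * (k : ℤ) ^ 2 := by
    rw [← hp, w_mul]
    have h1 := abs_le.1 (abs_dotProduct_le hfx hgy)
    have h2 := abs_le.1 (abs_dotProduct_le hgx hfy)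
    rw [abs_le] at hfw hgw ⊢
    constructor <;> nlinarith
  choose s hs using fun i => exists_sign_abs_sub_le (hpx i)
  choose t ht using fun i => exists_sign_abs_sub_le (hpy i)
  let a : Fin n → ℤ := fun i => bif s i then (k : ℤ) else -k
  let b : Fin n → ℤ := fun i => bif t i then (k : ℤ) else -k
  have ha : ∀ i, |a i| ≤ k := fun i => by
    simp only [a]
    cases s i <;> simp
  have hb : ∀ i, |b i| ≤ k := fun i => by
    simp only [b]
    cases t i <;> simp
  -- The four terms are at most `2n + 2`, `n`, `2n` and `2n` times `k ^ 2`, in total `7n + 2`;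
  -- rounding costs one more.
  obtain ⟨m, hm, hmR⟩ := exists_approx_multiple (R := p.w + a ⬝ᵥ b - a ⬝ᵥ p.y + p.x ⬝ᵥ b)
    (K := (k : ℤ) ^ 2) (M := 7 * n + 2) (by positivity) (by positivity) (by
      have h1 := abs_le.1 (abs_dotProduct_le ha hb)
      have h2 := abs_le.1 (abs_dotProduct_le ha hpy)
      have h3 := abs_le.1 (abs_dotProduct_le hpx hb)
      rw [abs_le] at hpw ⊢
      constructor <;> nlinarith)
  have hmem : boxShift n k (s, t, m) ∈ Finset.image (boxShift n k)
      ((Finset.univ : Finset (Fin n → Bool)) ×ˢ (Finset.univ : Finset (Fin n → Bool)) ×ˢ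
        Finset.Icc (-(7 * n + 3 : ℤ)) (7 * n + 3)) := by
    refine Finset.mem_image_of_mem _ ?_
    rw [abs_le] at hm
    simp only [Finset.mem_product, Finset.mem_univ, true_and, Finset.mem_Icc]
    constructor <;> linarith
  refine ⟨_, hmem, (boxShift n k (s, t, m))⁻¹ * p, ⟨fun i => ?_, fun i => ?_, ?_⟩,
    (mul_inv_cancel_left _ _).trans hp.symm⟩
  · refine le_of_eq_of_le (congrArg abs ?_) (hs i)
    simp only [mul_x, inv_x, Pi.add_apply, Pi.neg_apply, boxShift]
    ring
  · refine le_of_eq_of_le (congrArg abs ?_) (ht i)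
    simp only [mul_y, inv_y, Pi.add_apply, Pi.neg_apply, boxShift]
    ring
  · refine le_of_eq_of_le (congrArg abs ?_) hmR
    have hwq : (boxShift n k (s, t, m)).w = 2 * (m * k ^ 2) - a ⬝ᵥ b := rfl
    have hxq : (boxShift n k (s, t, m)).x = a := rfl
    have hyq : (boxShift n k (s, t, m)).y = b := rfl
    rw [w_mul, w_inv, inv_x, inv_y, hwq, hxq, hyq, neg_dotProduct, dotProduct_neg]
    ring

theorem hasApproximateSubgroupFolner (n : ℕ) : HasApproximateSubgroupFolner (Heisenberg n) :=
  ⟨box n, _, isFolnerSequence_box n, isApproximateSubgroup_box n⟩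

instance : Countable (Heisenberg n) :=
  Function.Injective.countable (f := fun h : Heisenberg n => (h.x, h.y, h.z)) fun a b h => by
    simp only [Prod.mk.injEq] at h
    exact Heisenberg.ext h.1 h.2.1 h.2.2

end Heisenberg

theorem mainTheorem10 (n : ℕ) (hn : 1 ≤ n)
    {G : Type*} [Group G] [Countable G]
    (hG : Finite G ∨ ((∀ a b : G, a * b = b * a) ∧ Group.FG G) ∨
      IsLocallyFiniteGroup G ∨ HasSymmetricWAFC G)
    {X : Type*} [MetricSpace X] [CompactSpace X] [Nonempty X]
    (hdim : coveringDim X < ⊤)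
    [MulAction (Heisenberg n × G) X] [ContinuousConstSMul (Heisenberg n × G) X]
    (hfree : IsFreeAction (Heisenberg n × G) X) :
    topRokhlinDim (Heisenberg n × G) X < ⊤ := by
  obtain ⟨d, hd⟩ := iInf_lt_top.1 hdim
  obtain ⟨hX, -⟩ := iInf_lt_top.1 hd
  have hGF : HasApproximateSubgroupFolner G := by
    rcases hG with h | ⟨hcomm, hfg⟩ | h | h
    · exact IsLocallyFiniteGroup.hasApproximateSubgroupFolner fun H _ => inferInstance
    · exact hasApproximateSubgroupFolner_of_comm_of_fg hcomm hfg
    · exact h.hasApproximateSubgroupFolner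
    · exact h.hasApproximateSubgroupFolner
  obtain ⟨F, L, hF, hFL⟩ := (Heisenberg.hasApproximateSubgroupFolner n).prod hGF
  have := TopRokhlinDimLE.of_approximateSubgroups hfree hX hF hFL
  exact iInf_lt_top.2 ⟨_, iInf_lt_top.2 ⟨this, ENat.natCast_lt_top _⟩⟩
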